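/- Let $k$ be a field of characteristic $0$, $K$ a commutative $k$-algebra and $V$ a $K$-module. For $k$-subspaces $A,B$ of a $K$-module $U$ write $A<B$ if $\dim_k (A+B)/B<\infty$, and let $$E=\{\varphi\in\operatorname{End}_k(U):\varphi A<A\},\quad E_1=\{\varphi:\varphi U<A\},\quad E_2=\{\varphi:\varphi A<(0)\}.$$ If $fA<A$ for all $f\in K$, the abstract (Tate) residue at $A$ is the unique $k$-linear map $\operatorname{res}_A^U\colon\Omega^1_{K/k}\to k$ such that, for all $f,g\in K$, $\operatorname{res}_A^U(f\,dg)=\operatorname{tr}_U[f_1,g_1]$ for all $f_1,g_1\in E$ with $f\equiv f_1$ and $g\equiv g_1 \pmod{E_2}$ and at least one of $f_1,g_1$ in $E_1$. Here $\operatorname{tr}_U(\varphi)$, for an endomorphism $\varphi$ with $\varphi^nU$ finite dimensional for some $n$, is the ordinary trace of $\varphi$ on $\varphi^nU$. For $g,h\in K$ put $$c_A^U(g,h)=\exp_{z^2}\!\big(\tfrac12\operatorname{res}_A^U(g\,dh)\big)\in k((z))^\times,\qquad \exp_{z^2}(x)=\sum_{n\ge 0}\frac{x^n z^{2n}}{n!}.$$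 Let $\{V_i\}_{i\in I}$ be a family of $k$-subspaces of $V$ such that, for every $g\in K$, $gV_i<V_i$ for all $i$, and $gV_i=V_i$ or $gV_i=\{0\}$ for all but finitely many $i$. Let $\{W_i\}_{i\in I}$ be a family of $k$-subspaces of $V$ with $V_i\subseteq W_i$ and $gW_i\subseteq W_i$ for all $i\in I$ and $g\in K$. Let $A_I=\prod_{i\in I}V_i\subseteq W_I=\prod_{i\in I}W_i$, with $K$ acting diagonally on $W_I$. Then: 1. For each $i\in I$, and for each of the pairs $(A,U)=(V_i,V)$, $(V_i,W_i)$ and $(A_I,W_I)$, one has $fA<A$ for all $f\in K$, the residue map $\operatorname{res}_A^U$ exists and is unique, and $c_A^U$ is a $2$-cocycle of the additive group of $K$ with coefficients in $k((z))^\times$ (trivial action). 2. For all $g,h\in K$, $c^{W_i}_{V_i}(g,h)\neq 1$ for only finitely many $i\in I$, and $$c^{W_I}_{A_I}(g,h)=\prod_{i\in I}c^{W_i}_{V_i}(g,h).$$ 3. Hence, for $g,h\in K$ with $c^{W_I}_{A_I}(g,h)=1$, one has $\prod_{i\in I}c^{W_i}_{V_i}(g,h)=1$. -/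

import Mathlib

open scoped KaehlerDifferential

namespace SegalWilson

noncomputable section

/-! ### Tate's order on subspaces, and restricted endomorphisms -/

section Subspaces

variable {k V : Type*} [Field k] [AddCommGroup V] [Module k V]

/-- `A < B` in the sense of Tate: `(A + B) / B` (a subspace of `V / B`) is finite dimensional. -/
def AlmostLE (A B : Submodule k V) : Prop :=
  FiniteDimensional k ((A ⊔ B).map B.mkQ)

/-- `E(V, A)`: the endomorphisms `φ` of `V` with `φ A < A`. -/
def E (A : Submodule k V) : Set (Module.End k V) :=
  {φ | AlmostLE (A.map φ) A}

/-- `E₁(V, A)`: the endomorphisms `φ` of `V` with `φ V < A`. -/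
def E₁ (A : Submodule k V) : Set (Module.End k V) :=
  {φ | AlmostLE ((⊤ : Submodule k V).map φ) A}

/-- `E₂(V, A)`: the endomorphisms `φ` of `V` with `φ A < (0)`. -/
def E₂ (A : Submodule k V) : Set (Module.End k V) :=
  {φ | AlmostLE (A.map φ) ⊥}

/-- `E(V, {V_i})`: the endomorphisms `g` of `V` with `g V_i < V_i` for all `i`, and
`g V_i = V_i` or `g V_i = 0` for almost all `i`. -/
def restrictedEnd {I : Type*} (A : I → Submodule k V) : Set (Module.End k V) :=
  {g | (∀ i, AlmostLE ((A i).map g) (A i)) ∧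
    ∀ᶠ i in Filter.cofinite, (A i).map g = A i ∨ (A i).map g = ⊥}

/-- `φ` is finite potent: `φ ^ n V` is finite dimensional for some `n`. -/
def IsFinitePotent (φ : Module.End k V) : Prop :=
  ∃ n : ℕ, FiniteDimensional k (LinearMap.range (φ ^ n))

theorem map_mem_range_pow (φ : Module.End k V) (n : ℕ) :
    ∀ x ∈ LinearMap.range (φ ^ n), φ x ∈ LinearMap.range (φ ^ n) := by
  rintro _ ⟨y, rfl⟩
  exact ⟨φ y, by rw [← Module.End.mul_apply, ← Module.End.mul_apply, ← pow_succ, ← pow_succ']⟩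

open Classical in
/-- Tate's trace of a finite potent endomorphism `φ`: the ordinary trace of `φ` on the invariant
finite dimensional subspace `φ ^ n V`, with `n` minimal (any larger `n` gives the same value).
It is `0` by convention if `φ` is not finite potent. -/
def tateTrace (φ : Module.End k V) : k :=
  if h : IsFinitePotent φ then
    LinearMap.trace k (LinearMap.range (φ ^ Nat.find h))
      (φ.restrict (map_mem_range_pow φ (Nat.find h)))
  else 0

end Subspaces

/-! ### The abstract residue -/

section Residue

variable {k : Type*} (K : Type*) {V : Type*} [Field k] [CommRing K] [Algebra k K]
  [AddCommGroup V] [Module k V] [Module K V] [IsScalarTower k K V]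

/-- The property that characterizes the residue map of the `K`-module `V` at the `k`-subspace `A`:
`r (f dg) = tr [f₁, g₁]` for all `f₁, g₁ ∈ E` with `f ≡ f₁`, `g ≡ g₁` modulo `E₂`, at least one
of which lies in `E₁`. -/
def IsAbstractResidue (A : Submodule k V) (r : Ω[K⁄k] →ₗ[k] k) : Prop :=
  ∀ (f g : K) (f₁ g₁ : Module.End k V), f₁ ∈ E A → g₁ ∈ E A →
    Algebra.lsmul k k V f - f₁ ∈ E₂ A → Algebra.lsmul k k V g - g₁ ∈ E₂ A →
    (f₁ ∈ E₁ A ∨ g₁ ∈ E₁ A) →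
    r (f • KaehlerDifferential.D k K g) = tateTrace (f₁ * g₁ - g₁ * f₁)

/-- `f A < A` for all `f ∈ K`, and there is exactly one residue map at `A`. -/
def HasAbstractResidue (A : Submodule k V) : Prop :=
  (∀ f : K, Algebra.lsmul k k V f ∈ E A) ∧
    ∃! r : Ω[K⁄k] →ₗ[k] k, IsAbstractResidue K A r

open Classical in
/-- The abstract residue `res_A^V : Ω¹_{K/k} → k` (zero by convention if there is none). -/
def abstractResidue (A : Submodule k V) : Ω[K⁄k] →ₗ[k] k :=
  if h : ∃ r : Ω[K⁄k] →ₗ[k] k, IsAbstractResidue K A r then h.choose else 0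

end Residue

/-! ### The Segal-Wilson cocycle -/

section Cocycle

variable {k : Type*} [Field k] [CharZero k]

/-- The power series `exp (z² x) = ∑ₙ xⁿ z²ⁿ / n!`. -/
def expZSqSeries (x : k) : PowerSeries k :=
  PowerSeries.expand 2 two_ne_zero (PowerSeries.rescale x (PowerSeries.exp k))

theorem expZSqSeries_mul (x y : k) :
    expZSqSeries x * expZSqSeries y = expZSqSeries (x + y) := by
  rw [expZSqSeries, expZSqSeries, expZSqSeries, ← PowerSeries.exp_mul_exp_eq_exp_add, map_mul]

theorem expZSqSeries_zero : expZSqSeries (0 : k) = 1 := by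
  simp [expZSqSeries]

/-- `exp_{z²}(x) = ∑ₙ xⁿ z²ⁿ / n!` as an element of `k((z))ˣ`. -/
def expZSq (x : k) : (LaurentSeries k)ˣ :=
  Units.map (HahnSeries.ofPowerSeries ℤ k : PowerSeries k →* LaurentSeries k)
    { val := expZSqSeries x
      inv := expZSqSeries (-x)
      val_inv := by rw [expZSqSeries_mul, add_neg_cancel, expZSqSeries_zero]
      inv_val := by rw [expZSqSeries_mul, neg_add_cancel, expZSqSeries_zero] }

variable {K V : Type*} [CommRing K] [Algebra k K]
  [AddCommGroup V] [Module k V] [Module K V] [IsScalarTower k K V]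

/-- `c_A^V (g, h) = exp_{z²}(½ res_A^V (g dh))`. -/
def segalWilsonCocycle (A : Submodule k V) (g h : K) : (LaurentSeries k)ˣ :=
  expZSq ((1 / 2 : k) * abstractResidue K A (g • KaehlerDifferential.D k K h))

/-- `c` is a 2-cocycle of the additive group `K` with coefficients in the (trivial `K`-module)
abelian group `M`. -/
def IsTwoCocycle {K M : Type*} [AddCommGroup K] [CommGroup M] (c : K → K → M) : Prop :=
  ∀ g h l : K, c h l * c g (h + l) = c (g + h) l * c g h

end Cocycle

/-! ### Families of subspaces -/

section Families

variable {k K V : Type*} [Field k] [CommRing K] [Algebra k K]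
  [AddCommGroup V] [Module k V] [Module K V] [IsScalarTower k K V]

/-- The `k`-subspace `A ∩ W` of `V`, as a `k`-subspace of the `K`-submodule `W` of `V`
(for `A ⊆ W` this is `A` itself, seen in `W`). -/
def subspaceIn (A : Submodule k V) (W : Submodule K V) : Submodule k W :=
  A.comap (W.subtype.restrictScalars k)

/-- The `k`-subspace `A_I = ∏ V_i` of `W_I = ∏ W_i`. -/
def productSubspace {I : Type*} (A : I → Submodule k V) (W : I → Submodule K V) :
    Submodule k (∀ i, W i) :=
  Submodule.pi Set.univ fun i => subspaceIn (A i) (W i)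

end Families

end

end SegalWilson

namespace SegalWilson

noncomputable section

/-! ### Calculus of Tate's order on subspaces -/

section AlmostLE

variable {k V : Type*} [Field k] [AddCommGroup V] [Module k V]

/-! The cocycle is an exponential of half a residue, so the product formula is additivity of
residues over the factors of `∏ W i`.

With a projection `P` onto `A`, the residue of `f dg` is `tr [Pf, g]`, because `Pf` is a lift of `f`
in `E₁`. Tate's trace is not linear on all finite potent maps. It is linear on `E₀`, where any
product of two elements has finite rank (`tateTrace_smul_add_smul`), and `tr (uv) = tr (vu)` makes
the value independent of lifts (`tateTrace_commutator_eq`). That freedom yields the Leibniz rule,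
hence a linear form on `Ω[K⁄k]` (`hasAbstractResidue`).

On the product, projecting factorwise makes the commutator diagonal. If `f` and `g` both map `B i`
into itself, as they do for almost all `i`, the `i`-th component has square zero. So finitely many
components carry the trace; the rest together have square zero and contribute nothing, even if their
rank is infinite (`tateTrace_pi`). -/

theorem almostLE_iff {A B : Submodule k V} :
    AlmostLE A B ↔ ∃ F : Submodule k V, FiniteDimensional k F ∧ A ≤ B ⊔ F := by
  unfold AlmostLE
  constructor
  · intro h
    obtain ⟨s, hs⟩ := (Submodule.fg_iff_finiteDimensional _).2 h
    obtain ⟨t, ht⟩ : ∃ t : (V ⧸ B) → V, ∀ x, B.mkQ (t x) = x :=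
      ⟨_, Function.surjInv_eq B.mkQ_surjective⟩
    refine ⟨Submodule.span k (t '' s), FiniteDimensional.span_of_finite k (s.finite_toSet.image t),
      fun a ha => ?_⟩
    have h1 : B.mkQ a ∈ Submodule.map B.mkQ (Submodule.span k (t '' s)) := by
      have h2 : B.mkQ '' (t '' s) = s := by
        rw [← Set.image_comp]
        exact (Set.image_congr fun x _ => ht x).trans (Set.image_id _)
      rw [Submodule.map_span, h2, hs]
      exact Submodule.mem_map_of_mem (Submodule.mem_sup_left ha)
    have h3 := Submodule.comap_map_mkQ B (Submodule.span k (t '' s))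
    exact h3 ▸ (Submodule.mem_comap.2 h1)
  · rintro ⟨F, hF, h⟩
    have hle : (A ⊔ B).map B.mkQ ≤ F.map B.mkQ := by
      calc (A ⊔ B).map B.mkQ ≤ (B ⊔ F).map B.mkQ :=
            Submodule.map_mono (sup_le h le_sup_left)
        _ = F.map B.mkQ := by rw [Submodule.map_sup, Submodule.mkQ_map_self, bot_sup_eq]
    exact Submodule.finiteDimensional_of_le hle

theorem AlmostLE.of_le {A B : Submodule k V} (h : A ≤ B) : AlmostLE A B :=
  almostLE_iff.2 ⟨⊥, inferInstance, h.trans le_sup_left⟩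

theorem AlmostLE.trans {A B C : Submodule k V} (h₁ : AlmostLE A B) (h₂ : AlmostLE B C) :
    AlmostLE A C := by
  obtain ⟨F, hF, h⟩ := almostLE_iff.1 h₁
  obtain ⟨G, hG, h'⟩ := almostLE_iff.1 h₂
  exact almostLE_iff.2 ⟨G ⊔ F, inferInstance, h.trans (by rw [← sup_assoc]; gcongr)⟩

theorem AlmostLE.sup {A B C : Submodule k V} (h₁ : AlmostLE A C) (h₂ : AlmostLE B C) :
    AlmostLE (A ⊔ B) C := by
  obtain ⟨F, hF, h⟩ := almostLE_iff.1 h₁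
  obtain ⟨G, hG, h'⟩ := almostLE_iff.1 h₂
  refine almostLE_iff.2 ⟨F ⊔ G, inferInstance, sup_le (h.trans ?_) (h'.trans ?_)⟩
  · exact sup_le_sup_left le_sup_left _
  · exact sup_le_sup_left le_sup_right _

theorem AlmostLE.map {U : Type*} [AddCommGroup U] [Module k U] {A B : Submodule k V}
    (h : AlmostLE A B) (φ : V →ₗ[k] U) : AlmostLE (A.map φ) (B.map φ) := by
  obtain ⟨F, hF, h⟩ := almostLE_iff.1 h
  exact almostLE_iff.2 ⟨F.map φ, inferInstance, by
    rw [← Submodule.map_sup]; exact Submodule.map_mono h⟩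

theorem almostLE_bot_iff {A : Submodule k V} : AlmostLE A ⊥ ↔ FiniteDimensional k A := by
  rw [almostLE_iff]
  constructor
  · rintro ⟨F, hF, h⟩
    exact Submodule.finiteDimensional_of_le (h.trans (bot_sup_eq F).le)
  · exact fun h => ⟨A, h, le_sup_right⟩

/-- The endomorphisms `φ` with `φ B < C`. -/
def almostMap (B C : Submodule k V) : Submodule k (Module.End k V) where
  carrier := {φ | AlmostLE (B.map φ) C}
  zero_mem' := .of_le (by rw [Submodule.map_zero]; exact bot_le)
  add_mem' := fun {_ _} hφ hψ => (AlmostLE.of_le (Submodule.map_add_le _ _ _)).trans (hφ.sup hψ)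
  smul_mem' := fun c φ hφ => by
    refine AlmostLE.trans (.of_le ?_) hφ
    rintro _ ⟨x, hx, rfl⟩
    exact Submodule.smul_mem _ c (Submodule.mem_map_of_mem hx)

theorem mem_almostMap {B C : Submodule k V} {φ : Module.End k V} :
    φ ∈ almostMap B C ↔ AlmostLE (B.map φ) C := Iff.rfl

theorem almostMap_mono {B B' C C' : Submodule k V} (hB : B' ≤ B) (hC : C ≤ C') :
    almostMap B C ≤ almostMap B' C' := fun _ hφ =>
  ((AlmostLE.of_le (Submodule.map_mono hB)).trans hφ).trans (.of_le hC)

theorem mul_mem_almostMap {B C D : Submodule k V} {φ ψ : Module.End k V}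
    (hφ : φ ∈ almostMap C D) (hψ : ψ ∈ almostMap B C) : φ * ψ ∈ almostMap B D := by
  rw [mem_almostMap, Module.End.mul_eq_comp, Submodule.map_comp]
  exact (AlmostLE.map hψ φ).trans hφ

theorem mem_almostMap_of_le {B C : Submodule k V} {φ : Module.End k V} (h : B.map φ ≤ C) :
    φ ∈ almostMap B C := AlmostLE.of_le h

/-- `E₀(V, A) = E₁(V, A) ∩ E₂(V, A)`. -/
def E₀ (A : Submodule k V) : Submodule k (Module.End k V) :=
  almostMap ⊤ A ⊓ almostMap A ⊥

variable {A : Submodule k V} {φ ψ : Module.End k V}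

theorem mul_mem_E₀_left (hφ : φ ∈ almostMap A A) (hψ : ψ ∈ E₀ A) : φ * ψ ∈ E₀ A :=
  ⟨mul_mem_almostMap hφ hψ.1, mul_mem_almostMap (almostMap_mono bot_le le_rfl
    (mem_almostMap_of_le (by simp) : φ ∈ almostMap (⊥ : Submodule k V) ⊥)) hψ.2⟩

theorem mul_mem_E₀_right (hφ : φ ∈ E₀ A) (hψ : ψ ∈ almostMap A A) : φ * ψ ∈ E₀ A :=
  ⟨mul_mem_almostMap hφ.1 (mem_almostMap_of_le le_top), mul_mem_almostMap hφ.2 hψ⟩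

theorem E₁_mul_E₂_mem_E₀ (hφ : φ ∈ almostMap ⊤ A) (hψ : ψ ∈ almostMap A ⊥) : φ * ψ ∈ E₀ A :=
  ⟨mul_mem_almostMap hφ (mem_almostMap_of_le le_top),
    mul_mem_almostMap (almostMap_mono bot_le le_rfl
      (mem_almostMap_of_le (by simp) : φ ∈ almostMap (⊥ : Submodule k V) ⊥)) hψ⟩

theorem E₂_mul_E₁_mem_E₀ (hφ : φ ∈ almostMap A ⊥) (hψ : ψ ∈ almostMap ⊤ A) : φ * ψ ∈ E₀ A :=
  ⟨almostMap_mono le_rfl bot_le (mul_mem_almostMap hφ hψ),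
    almostMap_mono le_top le_rfl (mul_mem_almostMap hφ hψ)⟩

/-- Up to finite dimension, `ψ` sends everything into `A` and `φ` kills `A`. This is what makes
traces on `E₀` well behaved. -/
theorem finiteDimensional_range_mul (hφ : φ ∈ E₀ A) (hψ : ψ ∈ E₀ A) :
    FiniteDimensional k (LinearMap.range (φ * ψ)) := by
  rw [LinearMap.range_eq_map]
  exact almostLE_bot_iff.1 (mul_mem_almostMap hφ.2 hψ.1)

theorem isFinitePotent_of_mem_E₀ (hφ : φ ∈ E₀ A) : IsFinitePotent φ :=
  ⟨2, by rw [pow_two]; exact finiteDimensional_range_mul hφ hφ⟩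

end AlmostLE

/-! ### Tate's trace -/

section Trace

variable {k V : Type*} [Field k] [AddCommGroup V] [Module k V]

/-- `φ` induces `u : F → G`; with the inclusion `ι : G → F`, the two restrictions are `ι ∘ u` and `u
∘ ι`. -/
theorem trace_restrict_eq_of_map_le {φ : Module.End k V} {F G : Submodule k V}
    [FiniteDimensional k F] (hGF : G ≤ F) (hF : ∀ x ∈ F, φ x ∈ F) (hG : ∀ x ∈ G, φ x ∈ G)
    (h : F.map φ ≤ G) :
    LinearMap.trace k F (φ.restrict hF) = LinearMap.trace k G (φ.restrict hG) := by
  have : FiniteDimensional k G := Submodule.finiteDimensional_of_le hGF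
  let u : F →ₗ[k] G := φ.restrict fun x hx => h (Submodule.mem_map_of_mem hx)
  have h1 : φ.restrict hF = Submodule.inclusion hGF ∘ₗ u := rfl
  have h2 : φ.restrict hG = u ∘ₗ Submodule.inclusion hGF := rfl
  rw [h1, h2, LinearMap.trace_comp_comm']

theorem trace_restrict_eq_of_map_pow_le {φ : Module.End k V} (n : ℕ) {F G : Submodule k V}
    [FiniteDimensional k F] (hGF : G ≤ F) (hF : ∀ x ∈ F, φ x ∈ F) (hG : ∀ x ∈ G, φ x ∈ G)
    (h : F.map (φ ^ n) ≤ G) :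
    LinearMap.trace k F (φ.restrict hF) = LinearMap.trace k G (φ.restrict hG) := by
  induction n generalizing F with
  | zero =>
    obtain rfl : F = G := le_antisymm (by simpa [Module.End.one_eq_id] using h) hGF
    rfl
  | succ n ih =>
    -- Interpose `G ⊔ φ F`: one application of `φ` takes `F` into it, and `n` more take it into `G`.
    have hHF : G ⊔ F.map φ ≤ F := sup_le hGF (by rintro _ ⟨x, hx, rfl⟩; exact hF x hx)
    have hH : ∀ x ∈ G ⊔ F.map φ, φ x ∈ G ⊔ F.map φ := fun x hx =>
      Submodule.mem_sup_right (Submodule.mem_map_of_mem (hHF hx))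
    have : FiniteDimensional k ↥(G ⊔ F.map φ) := Submodule.finiteDimensional_of_le hHF
    rw [trace_restrict_eq_of_map_le hHF hF hH le_sup_right]
    refine ih le_sup_left hH ?_
    rw [Submodule.map_sup, ← Submodule.map_comp, ← Module.End.mul_eq_comp, ← pow_succ]
    refine sup_le ?_ h
    rintro _ ⟨x, hx, rfl⟩
    exact Module.End.pow_apply_mem_of_forall_mem n hG x hx

/-- Tate's trace is the trace on any finite dimensional invariant subspace that contains the
image of a power. -/
theorem tateTrace_eq_trace_restrict {φ : Module.End k V} {F : Submodule k V}
    [FiniteDimensional k F] (hF : ∀ x ∈ F, φ x ∈ F) {n : ℕ} (hn : LinearMap.range (φ ^ n) ≤ F) :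
    tateTrace φ = LinearMap.trace k F (φ.restrict hF) := by
  classical
  have h : IsFinitePotent φ := ⟨n, Submodule.finiteDimensional_of_le hn⟩
  rw [tateTrace, dif_pos h]
  set m := Nat.find h with hm
  have hfin : FiniteDimensional k (LinearMap.range (φ ^ m)) := Nat.find_spec h
  have hle : ∀ a b : ℕ, LinearMap.range (φ ^ (a + b)) ≤ LinearMap.range (φ ^ a) := by
    rintro a b _ ⟨x, rfl⟩
    exact ⟨(φ ^ b) x, by rw [pow_add]; rfl⟩
  have hp : ∀ (a b : ℕ), (LinearMap.range (φ ^ b)).map (φ ^ a) = LinearMap.range (φ ^ (a + b)) := by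
    intro a b
    rw [pow_add, Module.End.mul_eq_comp, LinearMap.range_comp]
  -- The range of `φ ^ (m + n)` lies both in the range that defines the trace and in `F`, so both
  -- traces are compared with the one there.
  rw [trace_restrict_eq_of_map_pow_le n (hle m n) _ (map_mem_range_pow φ (m + n))
      (by rw [hp, add_comm]),
    trace_restrict_eq_of_map_pow_le (m + n) ((add_comm m n ▸ hle n m).trans hn) hF
      (map_mem_range_pow φ (m + n)) ?_]
  rintro _ ⟨x, -, rfl⟩
  exact ⟨x, rfl⟩

theorem tateTrace_eq_zero_of_sq {φ : Module.End k V} (h : φ * φ = 0) : tateTrace φ = 0 := by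
  rw [tateTrace_eq_trace_restrict (F := ⊥) (n := 2) (by simp) (by simp [pow_two, h])]
  convert map_zero (LinearMap.trace k (⊥ : Submodule k V))
  exact Subsingleton.elim _ _

/-- All three traces can be computed on one finite dimensional subspace, where linearity is the
ordinary one. -/
theorem tateTrace_smul_add_smul {A : Submodule k V} {φ ψ : Module.End k V} (hφ : φ ∈ E₀ A)
    (hψ : ψ ∈ E₀ A) (a b : k) :
    tateTrace (a • φ + b • ψ) = a * tateTrace φ + b * tateTrace ψ := by
  have h1 := finiteDimensional_range_mul hφ hφ
  have h2 := finiteDimensional_range_mul hφ hψ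
  have h3 := finiteDimensional_range_mul hψ hφ
  have h4 := finiteDimensional_range_mul hψ hψ
  -- `F₀` contains the images of all words of length two. Adding `φ F₀` and `ψ F₀` gives invariance,
  -- since a second letter lands back in `F₀`.
  let F₀ := (LinearMap.range (φ * φ) ⊔ LinearMap.range (φ * ψ)) ⊔
    (LinearMap.range (ψ * φ) ⊔ LinearMap.range (ψ * ψ))
  let F := F₀ ⊔ (F₀.map φ ⊔ F₀.map ψ)
  have l1 : LinearMap.range (φ * φ) ≤ F₀ := le_sup_left.trans le_sup_left
  have l2 : LinearMap.range (φ * ψ) ≤ F₀ := le_sup_right.trans le_sup_left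
  have l3 : LinearMap.range (ψ * φ) ≤ F₀ := le_sup_left.trans le_sup_right
  have l4 : LinearMap.range (ψ * ψ) ≤ F₀ := le_sup_right.trans le_sup_right
  have hF₀ : F₀ ≤ F := le_sup_left
  have hFφ : ∀ x ∈ F, φ x ∈ F := by
    suffices F ≤ F.comap φ from this
    refine sup_le (fun x hx => ?_) (sup_le ?_ ?_)
    · exact Submodule.mem_sup_right (Submodule.mem_sup_left (Submodule.mem_map_of_mem hx))
    · rintro _ ⟨x, -, rfl⟩; exact hF₀ (l1 ⟨x, rfl⟩)
    · rintro _ ⟨x, -, rfl⟩; exact hF₀ (l2 ⟨x, rfl⟩)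
  have hFψ : ∀ x ∈ F, ψ x ∈ F := by
    suffices F ≤ F.comap ψ from this
    refine sup_le (fun x hx => ?_) (sup_le ?_ ?_)
    · exact Submodule.mem_sup_right (Submodule.mem_sup_right (Submodule.mem_map_of_mem hx))
    · rintro _ ⟨x, -, rfl⟩; exact hF₀ (l3 ⟨x, rfl⟩)
    · rintro _ ⟨x, -, rfl⟩; exact hF₀ (l4 ⟨x, rfl⟩)
  have hFs : ∀ x ∈ F, (a • φ + b • ψ) x ∈ F := fun x hx =>
    F.add_mem (F.smul_mem a (hFφ x hx)) (F.smul_mem b (hFψ x hx))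
  have hr : LinearMap.range ((a • φ + b • ψ) ^ 2) ≤ F := by
    rintro _ ⟨x, rfl⟩
    have : (a • φ + b • ψ) ^ 2 = (a * a) • (φ * φ) + (a * b) • (φ * ψ) + (b * a) • (ψ * φ)
        + (b * b) • (ψ * ψ) := by
      simp only [pow_two, add_mul, mul_add, smul_mul_smul_comm]
      abel
    rw [this]
    refine hF₀ (F₀.add_mem (F₀.add_mem (F₀.add_mem ?_ ?_) ?_) ?_)
    exacts [F₀.smul_mem _ (l1 ⟨x, rfl⟩), F₀.smul_mem _ (l2 ⟨x, rfl⟩),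
      F₀.smul_mem _ (l3 ⟨x, rfl⟩), F₀.smul_mem _ (l4 ⟨x, rfl⟩)]
  rw [tateTrace_eq_trace_restrict hFs hr,
    tateTrace_eq_trace_restrict hFφ (n := 2) (by rw [pow_two]; exact l1.trans hF₀),
    tateTrace_eq_trace_restrict hFψ (n := 2) (by rw [pow_two]; exact l4.trans hF₀),
    ← smul_eq_mul, ← smul_eq_mul, ← map_smul, ← map_smul, ← map_add]
  rfl

/-- On `F`, the range of `(uv)^n`, and on `v F`, this is the finite dimensional identity. The space
`v F` suffices for `vu` because `(vu)^(n+1) = v (uv)^n u`. -/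
theorem tateTrace_comp_comm {U : Type*} [AddCommGroup U] [Module k U] (u : V →ₗ[k] U)
    (v : U →ₗ[k] V) (h : IsFinitePotent (u ∘ₗ v : Module.End k U)) :
    tateTrace (u ∘ₗ v : Module.End k U) = tateTrace (v ∘ₗ u : Module.End k V) := by
  obtain ⟨n, hn⟩ := h
  set F := LinearMap.range ((u ∘ₗ v : Module.End k U) ^ n) with hF
  have hFs : ∀ x ∈ F, (u ∘ₗ v) x ∈ F := map_mem_range_pow _ n
  have hvu : ∀ x ∈ F.map v, u x ∈ F := by rintro _ ⟨x, hx, rfl⟩; exact hFs x hx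
  have huv : ∀ x ∈ F, v x ∈ F.map v := fun x hx => Submodule.mem_map_of_mem hx
  have hpow : ∀ m : ℕ, (v ∘ₗ u : Module.End k V) ^ (m + 1)
      = v ∘ₗ ((u ∘ₗ v : Module.End k U) ^ m) ∘ₗ u := by
    intro m
    induction m with
    | zero => ext x; simp
    | succ m ih => rw [pow_succ, ih, pow_succ]; rfl
  have hr : LinearMap.range ((v ∘ₗ u : Module.End k V) ^ (n + 1)) ≤ F.map v := by
    rw [hpow]
    rintro _ ⟨x, rfl⟩
    exact Submodule.mem_map_of_mem ⟨u x, rfl⟩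
  rw [tateTrace_eq_trace_restrict hFs le_rfl,
    tateTrace_eq_trace_restrict (fun x hx => huv _ (hvu x hx)) hr]
  exact LinearMap.trace_comp_comm' (v.restrict huv) (u.restrict hvu)

variable {A : Submodule k V} {φ ψ : Module.End k V}

theorem tateTrace_add (hφ : φ ∈ E₀ A) (hψ : ψ ∈ E₀ A) :
    tateTrace (φ + ψ) = tateTrace φ + tateTrace ψ := by
  simpa using tateTrace_smul_add_smul hφ hψ 1 1

theorem tateTrace_sub (hφ : φ ∈ E₀ A) (hψ : ψ ∈ E₀ A) :
    tateTrace (φ - ψ) = tateTrace φ - tateTrace ψ := by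
  simpa [sub_eq_add_neg] using tateTrace_smul_add_smul hφ hψ 1 (-1)

theorem tateTrace_smul (hφ : φ ∈ E₀ A) (c : k) : tateTrace (c • φ) = c * tateTrace φ := by
  simpa using tateTrace_smul_add_smul hφ hφ c 0

theorem tateTrace_zero : tateTrace (0 : Module.End k V) = 0 :=
  tateTrace_eq_zero_of_sq (mul_zero 0)

theorem tateTrace_sum {ι : Type*} (s : Finset ι) {φ : ι → Module.End k V}
    (hφ : ∀ i, φ i ∈ E₀ A) : tateTrace (∑ i ∈ s, φ i) = ∑ i ∈ s, tateTrace (φ i) := by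
  classical
  induction s using Finset.induction_on with
  | empty => simpa using tateTrace_zero
  | insert i s hi ih =>
    rw [Finset.sum_insert hi, Finset.sum_insert hi,
      tateTrace_add (hφ i) (Submodule.sum_mem _ fun j _ => hφ j), ih]

theorem tateTrace_commutator_eq_zero (h₁ : φ * ψ ∈ E₀ A) (h₂ : ψ * φ ∈ E₀ A) :
    tateTrace (φ * ψ - ψ * φ) = 0 := by
  rw [tateTrace_sub h₁ h₂, sub_eq_zero]
  exact tateTrace_comp_comm φ ψ (isFinitePotent_of_mem_E₀ h₁)

end Trace

/-! ### Existence and uniqueness of the residue -/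

section Residue

variable {k K V : Type*} [Field k] [CommRing K] [Algebra k K]
  [AddCommGroup V] [Module k V] [Module K V] [IsScalarTower k K V]

/-- A bilinear form `c` with `c f (gh) = c (fg) h + c (fh) g` factors through `f dg`. -/
theorem exists_linearMap_kaehlerDifferential (c : K →ₗ[k] K →ₗ[k] k)
    (hc : ∀ f g h, c f (g * h) = c (f * g) h + c (f * h) g) :
    ∃ r : Ω[K⁄k] →ₗ[k] k, ∀ f g, r (f • KaehlerDifferential.D k K g) = c f g := by
  -- Let `K` act on its `k`-dual by precomposed multiplication. The hypothesis `hc` then says that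
  -- `g ↦ c (·, g)` is a derivation; its lift to differentials, evaluated at `1`, is `r`.
  let _ : Module K (K →ₗ[k] k) :=
    { smul := fun a φ => φ ∘ₗ LinearMap.mulLeft k a
      one_smul := fun φ => LinearMap.ext fun x => congrArg φ (one_mul x)
      mul_smul := fun a b φ => LinearMap.ext fun x =>
        congrArg φ (show a * b * x = b * (a * x) by ring)
      smul_zero := fun a => rfl
      smul_add := fun a φ ψ => rfl
      add_smul := fun a b φ => LinearMap.ext fun x =>
        (congrArg φ (add_mul a b x)).trans (map_add φ _ _)
      zero_smul := fun φ => LinearMap.ext fun x =>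
        (congrArg φ (zero_mul x)).trans (map_zero φ) }
  have smul_def : ∀ (a : K) (φ : K →ₗ[k] k) (x : K), (a • φ) x = φ (a * x) := fun _ _ _ => rfl
  have : IsScalarTower k K (K →ₗ[k] k) := ⟨fun t a φ => LinearMap.ext fun x => by
    rw [smul_def, smul_mul_assoc, map_smul, LinearMap.smul_apply, smul_def]⟩
  let D : Derivation k K (K →ₗ[k] k) := Derivation.mk' c.flip fun g h => LinearMap.ext fun f => by
    rw [LinearMap.add_apply, smul_def, smul_def]
    simp only [LinearMap.flip_apply]
    rw [hc, mul_comm g, mul_comm h]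
  refine ⟨(LinearMap.applyₗ (1 : K)) ∘ₗ D.liftKaehlerDifferential.restrictScalars k,
    fun f g => ?_⟩
  simp only [LinearMap.comp_apply, LinearMap.restrictScalars_apply, map_smul,
    Derivation.liftKaehlerDifferential_comp_D, LinearMap.applyₗ_apply_apply]
  rw [smul_def, mul_one]
  rfl

/-- The `dg` generate over `K`, but `r` is only `k`-linear, so the span induction must carry an
arbitrary multiplier `f`. -/
theorem linearMap_kaehlerDifferential_ext {r r' : Ω[K⁄k] →ₗ[k] k}
    (h : ∀ f g : K, r (f • KaehlerDifferential.D k K g) = r' (f • KaehlerDifferential.D k K g)) :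
    r = r' := by
  have key : ∀ ω : Ω[K⁄k], ∀ f : K, r (f • ω) = r' (f • ω) := by
    intro ω
    have hω : ω ∈ Submodule.span K (Set.range (KaehlerDifferential.D k K)) := by
      rw [KaehlerDifferential.span_range_derivation]; trivial
    induction hω using Submodule.span_induction with
    | mem x hx => obtain ⟨g, rfl⟩ := hx; exact fun f => h f g
    | zero => simp
    | add x y _ _ hx hy => intro f; rw [smul_add, map_add, map_add, hx, hy]
    | smul a x _ hx => intro f; rw [← mul_smul, hx]
  exact LinearMap.ext fun ω => by simpa using key ω 1

theorem exists_projection (A : Submodule k V) :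
    ∃ P : Module.End k V, (∀ x, P x ∈ A) ∧ ∀ x ∈ A, P x = x := by
  obtain ⟨p, hp⟩ := A.subtype.exists_leftInverse_of_injective A.ker_subtype
  exact ⟨A.subtype ∘ₗ p, fun x => (p x).2, fun x hx =>
    congrArg A.subtype (LinearMap.congr_fun hp ⟨x, hx⟩)⟩

variable {A : Submodule k V} {P f g f₁ g₁ : Module.End k V}

theorem mul_projection_mem_E₁ (hP : ∀ x, P x ∈ A) : P * f ∈ E₁ A :=
  mem_almostMap_of_le (by rintro _ ⟨x, -, rfl⟩; exact hP _)

theorem sub_projection_mul_mem_E₂ (hP' : ∀ x ∈ A, P x = x) (hf : f ∈ E A) :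
    f - P * f ∈ E₂ A := by
  have h : (1 - P) * f ∈ almostMap A ⊥ := by
    refine mul_mem_almostMap (C := A) (mem_almostMap_of_le ?_) hf
    rintro _ ⟨x, hx, rfl⟩
    simp [hP' x hx]
  rwa [sub_mul, one_mul] at h

theorem E₁_subset_E (h : f ∈ E₁ A) : f ∈ E A :=
  almostMap_mono le_top le_rfl (show f ∈ almostMap ⊤ A from h)

/-- The commutator of lifts of commuting `f` and `g`, one of them in `E₁`, lies in `E₀`. -/
theorem commutator_mem_E₀ (hf : f ∈ E A) (hg : g ∈ E A) (hfg : f * g = g * f)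
    (hf₁ : f₁ ∈ E A) (hg₁ : g₁ ∈ E A) (hf' : f - f₁ ∈ E₂ A) (hg' : g - g₁ ∈ E₂ A)
    (h : f₁ ∈ E₁ A ∨ g₁ ∈ E₁ A) : f₁ * g₁ - g₁ * f₁ ∈ E₀ A := by
  constructor
  · rcases h with h | h
    · exact Submodule.sub_mem _ (mul_mem_almostMap (C := ⊤) h (mem_almostMap_of_le le_top))
        (mul_mem_almostMap (C := A) hg₁ h)
    · exact Submodule.sub_mem _ (mul_mem_almostMap (C := A) hf₁ h)
        (mul_mem_almostMap (C := ⊤) h (mem_almostMap_of_le le_top))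
  · have hbot : ∀ φ : Module.End k V, φ ∈ almostMap (⊥ : Submodule k V) ⊥ := fun φ =>
      mem_almostMap_of_le (by simp)
    -- Since `fg = gf`, the commutator is a combination of terms each containing an `E₂` factor `f -
    -- f₁` or `g - g₁`.
    have e : f₁ * g₁ - g₁ * f₁ =
        ((g - g₁) * f + g₁ * (f - f₁)) - ((f - f₁) * g + f₁ * (g - g₁)) := by
      have : (g - g₁) * f + g₁ * (f - f₁) - ((f - f₁) * g + f₁ * (g - g₁))
        = f₁ * g₁ - g₁ * f₁ + (g * f - f * g) := by noncomm_ring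
      rw [this, hfg, sub_self, add_zero]
    rw [e]
    exact Submodule.sub_mem _
      (Submodule.add_mem _ (mul_mem_almostMap (C := A) hg' hf) (mul_mem_almostMap (hbot _) hf'))
      (Submodule.add_mem _ (mul_mem_almostMap (C := A) hf' hg) (mul_mem_almostMap (hbot _) hg'))

/-- Independence of `tr [f₁, g₁]` of the lifts, compared with the lift `(f₂, g)`, `f₂ ∈ E₁`. -/
theorem tateTrace_commutator_eq {f₂ : Module.End k V} (hf : f ∈ E A) (hg : g ∈ E A)
    (hfg : f * g = g * f)
    (hf₁ : f₁ ∈ E A) (hg₁ : g₁ ∈ E A) (hf' : f - f₁ ∈ E₂ A) (hg' : g - g₁ ∈ E₂ A)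
    (h : f₁ ∈ E₁ A ∨ g₁ ∈ E₁ A) (hf₂ : f₂ ∈ E₁ A) (hf₂' : f - f₂ ∈ E₂ A) :
    tateTrace (f₁ * g₁ - g₁ * f₁) = tateTrace (f₂ * g - g * f₂) := by
  have hg0 : g - g ∈ E₂ A := by rw [sub_self]; exact (almostMap A ⊥).zero_mem
  have m₁ := commutator_mem_E₀ hf hg hfg hf₁ hg₁ hf' hg' h
  have m₂ := commutator_mem_E₀ hf hg hfg (E₁_subset_E hf₂) hg hf₂' hg0 (.inl hf₂)
  have m₃ := commutator_mem_E₀ hf hg hfg (E₁_subset_E hf₂) hg₁ hf₂' hg' (.inl hf₂)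
  have hd : f₁ - f₂ ∈ almostMap A ⊥ := by
    have := (almostMap A ⊥).sub_mem hf₂' hf'
    rwa [sub_sub_sub_cancel_left] at this
  -- First exchange `f₁` for `f₂`, then `g₁` for `g`. In each exchange both products in the error
  -- commutator lie in `E₀`, so its trace vanishes.
  have s₁ : tateTrace ((f₁ - f₂) * g₁ - g₁ * (f₁ - f₂)) = 0 := by
    rcases h with h | h
    · have hd0 : f₁ - f₂ ∈ E₀ A := ⟨(almostMap ⊤ A).sub_mem h hf₂, hd⟩
      exact tateTrace_commutator_eq_zero (mul_mem_E₀_right hd0 hg₁) (mul_mem_E₀_left hg₁ hd0)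
    · exact tateTrace_commutator_eq_zero (E₂_mul_E₁_mem_E₀ hd h) (E₁_mul_E₂_mem_E₀ h hd)
  have s₂ : tateTrace (f₂ * (g - g₁) - (g - g₁) * f₂) = 0 :=
    tateTrace_commutator_eq_zero (E₁_mul_E₂_mem_E₀ hf₂ hg') (E₂_mul_E₁_mem_E₀ hg' hf₂)
  have e₁ : (f₁ - f₂) * g₁ - g₁ * (f₁ - f₂) = (f₁ * g₁ - g₁ * f₁) - (f₂ * g₁ - g₁ * f₂) := by
    noncomm_ring
  have e₂ : f₂ * (g - g₁) - (g - g₁) * f₂ = (f₂ * g - g * f₂) - (f₂ * g₁ - g₁ * f₂) := by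
    noncomm_ring
  rw [e₁, tateTrace_sub m₁ m₃, sub_eq_zero] at s₁
  rw [e₂, tateTrace_sub m₂ m₃, sub_eq_zero] at s₂
  rw [s₁, s₂]

theorem hasAbstractResidue (hA : ∀ f : K, Algebra.lsmul k k V f ∈ E A) :
    HasAbstractResidue K A := by
  obtain ⟨P, hP, hP'⟩ := exists_projection A
  let ρ : K →ₐ[k] Module.End k V := Algebra.lsmul k k V
  change ∀ f : K, ρ f ∈ E A at hA
  have comm : ∀ f g, ρ f * ρ g = ρ g * ρ f := fun f g => by rw [← map_mul, mul_comm, map_mul]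
  have hE₁ : ∀ f, P * ρ f ∈ E₁ A := fun f => mul_projection_mem_E₁ hP
  have hE₂ : ∀ f, ρ f - P * ρ f ∈ E₂ A := fun f => sub_projection_mul_mem_E₂ hP' (hA f)
  have hE₂0 : ∀ g, ρ g - ρ g ∈ E₂ A := fun g => by
    rw [sub_self]; exact (almostMap A ⊥).zero_mem
  have mem : ∀ f g, (P * ρ f) * ρ g - ρ g * (P * ρ f) ∈ E₀ A := fun f g =>
    commutator_mem_E₀ (hA f) (hA g) (comm f g) (E₁_subset_E (hE₁ f)) (hA g) (hE₂ f) (hE₂0 g)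
      (.inl (hE₁ f))
  have lift : ∀ (f g : K) (f₁ g₁ : Module.End k V), f₁ ∈ E A → g₁ ∈ E A →
      ρ f - f₁ ∈ E₂ A → ρ g - g₁ ∈ E₂ A → (f₁ ∈ E₁ A ∨ g₁ ∈ E₁ A) →
      tateTrace (f₁ * g₁ - g₁ * f₁) = tateTrace ((P * ρ f) * ρ g - ρ g * (P * ρ f)) :=
    fun f g f₁ g₁ hf₁ hg₁ hf' hg' h => tateTrace_commutator_eq (hA f) (hA g) (comm f g)
      hf₁ hg₁ hf' hg' h (hE₁ f) (hE₂ f)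
  let c : K →ₗ[k] K →ₗ[k] k := LinearMap.mk₂ k
    (fun f g => tateTrace ((P * ρ f) * ρ g - ρ g * (P * ρ f)))
    (fun f f' g => by
      rw [← tateTrace_add (mem f g) (mem f' g), map_add]
      congr 1; noncomm_ring)
    (fun t f g => by
      rw [smul_eq_mul, ← tateTrace_smul (mem f g), map_smul]
      simp only [mul_smul_comm, smul_mul_assoc, smul_sub])
    (fun f g g' => by
      rw [← tateTrace_add (mem f g) (mem f g'), map_add]
      congr 1; noncomm_ring)
    (fun t f g => by
      rw [smul_eq_mul, ← tateTrace_smul (mem f g), map_smul]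
      simp only [mul_smul_comm, smul_mul_assoc, smul_sub])
  have hc : ∀ f g, c f g = tateTrace ((P * ρ f) * ρ g - ρ g * (P * ρ f)) := fun f g => rfl
  -- With `F = Pf`, use `F g` as lift of `fg` and `h F` as lift of `fh`: then `[F, gh] = [F g, h] +
  -- [h F, g]` holds exactly.
  have leibniz : ∀ f g h, c f (g * h) = c (f * g) h + c (f * h) g := by
    intro f g h
    have a₁ : (P * ρ f) * ρ g ∈ E₁ A :=
      mul_mem_almostMap (C := ⊤) (hE₁ f) (mem_almostMap_of_le le_top)
    have a₂ : ρ (f * g) - (P * ρ f) * ρ g ∈ E₂ A := by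
      rw [map_mul, ← sub_mul]; exact mul_mem_almostMap (C := A) (hE₂ f) (hA g)
    have b₁ : ρ h * (P * ρ f) ∈ E₁ A := mul_mem_almostMap (C := A) (hA h) (hE₁ f)
    have b₂ : ρ (f * h) - ρ h * (P * ρ f) ∈ E₂ A := by
      rw [mul_comm, map_mul, ← mul_sub]
      exact mul_mem_almostMap (C := ⊥) (mem_almostMap_of_le (by simp)) (hE₂ f)
    rw [hc, hc, hc, ← lift (f * g) h _ _ (E₁_subset_E a₁) (hA h) a₂ (hE₂0 h) (.inl a₁),
      ← lift (f * h) g _ _ (E₁_subset_E b₁) (hA g) b₂ (hE₂0 g) (.inl b₁), ← tateTrace_add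
      (commutator_mem_E₀ (hA _) (hA _) (comm _ _) (E₁_subset_E a₁) (hA h) a₂ (hE₂0 h) (.inl a₁))
      (commutator_mem_E₀ (hA _) (hA _) (comm _ _) (E₁_subset_E b₁) (hA g) b₂ (hE₂0 g) (.inl b₁)),
      map_mul]
    congr 1
    noncomm_ring
  obtain ⟨r, hr⟩ := exists_linearMap_kaehlerDifferential c leibniz
  refine ⟨hA, r, fun f g f₁ g₁ hf₁ hg₁ hf' hg' h => ?_, fun r' hr' => ?_⟩
  · rw [hr, hc, lift f g f₁ g₁ hf₁ hg₁ hf' hg' h]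
  · refine linearMap_kaehlerDifferential_ext fun f g => ?_
    rw [hr, hc]
    exact hr' f g _ _ (E₁_subset_E (hE₁ f)) (hA g) (hE₂ f) (hE₂0 g) (.inl (hE₁ f))

/-- The residue in terms of a projection onto `A`. -/
theorem abstractResidue_smul_D (hA : ∀ f : K, Algebra.lsmul k k V f ∈ E A)
    (hP : ∀ x, P x ∈ A) (hP' : ∀ x ∈ A, P x = x) (f g : K) :
    abstractResidue K A (f • KaehlerDifferential.D k K g) =
      tateTrace ((P * Algebra.lsmul k k V f) * Algebra.lsmul k k V g -
        Algebra.lsmul k k V g * (P * Algebra.lsmul k k V f)) := by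
  have h := (hasAbstractResidue hA).2.exists
  rw [abstractResidue, dif_pos h]
  have h₁ : P * Algebra.lsmul k k V f ∈ E₁ A := mul_projection_mem_E₁ hP
  refine h.choose_spec f g _ _ (E₁_subset_E h₁) (hA g) (sub_projection_mul_mem_E₂ hP' (hA f))
    ?_ (.inl h₁)
  rw [sub_self]
  exact (almostMap A ⊥).zero_mem

theorem commutator_projection_mem_E₀ (hA : ∀ f : K, Algebra.lsmul k k V f ∈ E A)
    (hP : ∀ x, P x ∈ A) (hP' : ∀ x ∈ A, P x = x) (f g : K) :
    (P * Algebra.lsmul k k V f) * Algebra.lsmul k k V g -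
        Algebra.lsmul k k V g * (P * Algebra.lsmul k k V f) ∈ E₀ A := by
  have h₁ : P * Algebra.lsmul k k V f ∈ E₁ A := mul_projection_mem_E₁ hP
  refine commutator_mem_E₀ (hA f) (hA g) (by rw [← map_mul, mul_comm, map_mul])
    (E₁_subset_E h₁) (hA g) (sub_projection_mul_mem_E₂ hP' (hA f)) ?_ (.inl h₁)
  rw [sub_self]
  exact (almostMap A ⊥).zero_mem

end Residue

/-! ### The cocycle identity -/

section Cocycle

variable {k : Type*} [Field k] [CharZero k]

theorem expZSq_add (x y : k) : expZSq (x + y) = expZSq x * expZSq y :=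
  Units.ext (by simp [expZSq, ← expZSqSeries_mul])

theorem expZSq_zero : expZSq (0 : k) = 1 :=
  Units.ext (by simp [expZSq, expZSqSeries_zero])

theorem expZSq_sum {ι : Type*} (s : Finset ι) (x : ι → k) :
    expZSq (∑ i ∈ s, x i) = ∏ i ∈ s, expZSq (x i) := by
  classical
  induction s using Finset.induction_on with
  | empty => simpa using expZSq_zero
  | insert i s hi ih => rw [Finset.sum_insert hi, Finset.prod_insert hi, expZSq_add, ih]

variable {K V : Type*} [CommRing K] [Algebra k K]
  [AddCommGroup V] [Module k V] [Module K V] [IsScalarTower k K V]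

/-- `(g, h) ↦ res (g dh)` is biadditive, and a biadditive map is a 2-cocycle. No condition on `A`
enters, since `abstractResidue` is linear by type, default value included. -/
theorem isTwoCocycle_segalWilsonCocycle (A : Submodule k V) :
    IsTwoCocycle (fun g h : K => segalWilsonCocycle A g h) := by
  intro g h l
  simp only [segalWilsonCocycle, ← expZSq_add, map_add, smul_add, add_smul]
  congr 1
  ring

end Cocycle

/-! ### Passing from `V` to a stable subspace -/

section Families

variable {k K V : Type*} [Field k] [CommRing K] [Algebra k K]
  [AddCommGroup V] [Module k V] [Module K V] [IsScalarTower k K V]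

theorem lsmul_mem_E_subspaceIn {A : Submodule k V} {W : Submodule K V}
    (hAW : A ≤ W.restrictScalars k) {f : K} (hf : Algebra.lsmul k k V f ∈ E A) :
    Algebra.lsmul k k W f ∈ E (subspaceIn A W) := by
  obtain ⟨F, hF, h⟩ := almostLE_iff.1 hf
  have hfin : FiniteDimensional k (F.comap (W.subtype.restrictScalars k)) := by
    refine FiniteDimensional.of_injective
      ((W.subtype.restrictScalars k).restrict (p := F.comap (W.subtype.restrictScalars k)) (q := F)
        fun x hx => hx) ?_
    intro x y hxy
    exact Subtype.ext (Subtype.ext (congrArg (fun z : F => (z : V)) hxy))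
  refine almostLE_iff.2 ⟨_, hfin, ?_⟩
  rintro _ ⟨x, hx, rfl⟩
  obtain ⟨a, ha, y, hy, hay⟩ := Submodule.mem_sup.1 (h (Submodule.mem_map_of_mem hx))
  change a + y = f • (x : V) at hay
  -- The error `y = f x - a` is in `W`, as `W` is `K`-stable and contains `A`. Hence the error space
  -- `F` may be cut down to `W`.
  have hyW : y ∈ W := by
    rw [← add_sub_cancel_left a y, hay]
    exact W.sub_mem (W.smul_mem f x.2) (hAW ha)
  exact Submodule.mem_sup.2 ⟨⟨a, hAW ha⟩, ha, ⟨y, hyW⟩, hy, Subtype.ext hay⟩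

theorem map_lsmul_subspaceIn_le {A : Submodule k V} {W : Submodule K V} {f : K}
    (hf : A.map (Algebra.lsmul k k V f) ≤ A) :
    (subspaceIn A W).map (Algebra.lsmul k k W f) ≤ subspaceIn A W := by
  rintro _ ⟨x, hx, rfl⟩
  exact hf (Submodule.mem_map_of_mem hx)

end Families

/-! ### Residues on a product -/

section Product

theorem exists_finset_of_eventually_cofinite {I : Type*} {p : I → Prop}
    (h : ∀ᶠ i in Filter.cofinite, p i) : ∃ s : Finset I, ∀ i ∉ s, p i :=
  ⟨(Filter.eventually_cofinite.1 h).toFinset, fun i hi => by simpa using hi⟩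

variable {k K I : Type*} [Field k] [CommRing K] [Algebra k K] {U : I → Type*}
  [∀ i, AddCommGroup (U i)] [∀ i, Module k (U i)] [∀ i, Module K (U i)]
  [∀ i, IsScalarTower k K (U i)] {B : ∀ i, Submodule k (U i)}

open Classical in
/-- The endomorphism of `∏ U i` that is `φ` on the factor `U i` and `0` on the other factors. -/
def extendByZero (i : I) (φ : Module.End k (U i)) : Module.End k (∀ i, U i) :=
  LinearMap.single k U i ∘ₗ φ ∘ₗ LinearMap.proj i

theorem extendByZero_apply_same (i : I) (φ : Module.End k (U i)) (x : ∀ i, U i) :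
    extendByZero i φ x i = φ (x i) := by
  simp [extendByZero]

theorem extendByZero_apply_ne {i j : I} (h : j ≠ i) (φ : Module.End k (U i)) (x : ∀ i, U i) :
    extendByZero i φ x j = 0 := by
  simp [extendByZero, h]

theorem sum_extendByZero_apply_of_mem {s : Finset I} {j : I} (hj : j ∈ s)
    (φ : ∀ i, Module.End k (U i)) (x : ∀ i, U i) :
    (∑ i ∈ s, extendByZero i (φ i)) x j = φ j (x j) := by
  rw [LinearMap.sum_apply, Finset.sum_apply, Finset.sum_eq_single_of_mem j hj
    fun i _ hi => extendByZero_apply_ne hi.symm _ _, extendByZero_apply_same]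

theorem sum_extendByZero_apply_of_notMem {s : Finset I} {j : I} (hj : j ∉ s)
    (φ : ∀ i, Module.End k (U i)) (x : ∀ i, U i) :
    (∑ i ∈ s, extendByZero i (φ i)) x j = 0 := by
  rw [LinearMap.sum_apply, Finset.sum_apply]
  exact Finset.sum_eq_zero fun i hi => extendByZero_apply_ne (by rintro rfl; exact hj hi) _ _

theorem tateTrace_extendByZero {i : I} {φ : Module.End k (U i)} (hφ : φ ∈ E₀ (B i)) :
    tateTrace (extendByZero i φ) = tateTrace φ := by
  classical
  have e : (φ ∘ₗ LinearMap.proj i) ∘ₗ LinearMap.single k U i = φ := by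
    ext x; simp
  have h := tateTrace_comp_comm (φ ∘ₗ LinearMap.proj i) (LinearMap.single k U i)
    (by rw [e]; exact isFinitePotent_of_mem_E₀ hφ)
  rw [e] at h
  rw [h]
  unfold extendByZero
  congr!

theorem extendByZero_mem_E {i : I} {φ : Module.End k (U i)} (hφ : φ ∈ E (B i)) :
    extendByZero i φ ∈ E (Submodule.pi Set.univ B) := by
  classical
  have h₁ : (Submodule.pi Set.univ B).map (extendByZero i φ) ≤
      ((B i).map φ).map (LinearMap.single k U i) := by
    rintro _ ⟨x, hx, rfl⟩
    refine ⟨φ (x i), Submodule.mem_map_of_mem (hx i trivial), ?_⟩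
    unfold extendByZero
    congr!
  have h₂ : (B i).map (LinearMap.single k U i) ≤ Submodule.pi Set.univ B := by
    rintro _ ⟨x, hx, rfl⟩ j -
    rcases eq_or_ne j i with rfl | h
    · simpa using hx
    · simp [h]
  exact ((AlmostLE.of_le h₁).trans (AlmostLE.map hφ _)).trans (.of_le h₂)

/-- A diagonal endomorphism almost all of whose components stabilize `B i`. -/
theorem mem_E_pi {φ : ∀ i, Module.End k (U i)} {Φ : Module.End k (∀ i, U i)}
    (hΦ : ∀ x i, Φ x i = φ i (x i)) (hφ : ∀ i, φ i ∈ E (B i))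
    {s : Finset I} (hs : ∀ i ∉ s, (B i).map (φ i) ≤ B i) :
    Φ ∈ E (Submodule.pi Set.univ B) := by
  -- Removing the finitely many exceptional components leaves a map that honestly stabilizes the
  -- product.
  rw [← sub_add_cancel Φ (∑ i ∈ s, extendByZero i (φ i))]
  refine (almostMap (Submodule.pi Set.univ B) (Submodule.pi Set.univ B)).add_mem
    (mem_almostMap_of_le ?_) (Submodule.sum_mem _ fun i _ => extendByZero_mem_E (hφ i))
  rintro _ ⟨x, hx, rfl⟩ j -
  rw [LinearMap.sub_apply, Pi.sub_apply, hΦ]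
  by_cases hj : j ∈ s
  · rw [sum_extendByZero_apply_of_mem hj, sub_self]
    exact (B j).zero_mem
  · rw [sum_extendByZero_apply_of_notMem hj, sub_zero]
    exact hs j hj (Submodule.mem_map_of_mem (hx j trivial))

/-- The trace of a diagonal endomorphism almost all of whose components have square zero. -/
theorem tateTrace_pi {φ : ∀ i, Module.End k (U i)} {Φ : Module.End k (∀ i, U i)}
    (hΦ : ∀ x i, Φ x i = φ i (x i)) (hΦ' : Φ ∈ E₀ (Submodule.pi Set.univ B))
    (hφ : ∀ i, φ i ∈ E₀ (B i)) {s : Finset I} (hs : ∀ i ∉ s, φ i * φ i = 0) :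
    tateTrace Φ = ∑ i ∈ s, tateTrace (φ i) := by
  have h₀ : ∀ i, extendByZero i (φ i) ∈ E₀ (Submodule.pi Set.univ B) := by
    intro i
    -- Each component is `Φ` after the projector onto the `i`-th factor, which preserves the product
    -- subspace; so it stays in `E₀`.
    have e : extendByZero i (φ i) = Φ * extendByZero i 1 := by
      refine LinearMap.ext fun x => funext fun j => ?_
      rw [Module.End.mul_apply, hΦ]
      rcases eq_or_ne j i with rfl | h
      · rw [extendByZero_apply_same, extendByZero_apply_same, Module.End.one_apply]
      · rw [extendByZero_apply_ne h, extendByZero_apply_ne h, map_zero]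
    rw [e]
    exact mul_mem_E₀_right hΦ' (extendByZero_mem_E (mem_almostMap_of_le (by
      rintro _ ⟨x, hx, rfl⟩; exact hx)))
  have hsum := Submodule.sum_mem (E₀ (Submodule.pi Set.univ B)) (t := s) fun i _ => h₀ i
  have hν : tateTrace (Φ - ∑ i ∈ s, extendByZero i (φ i)) = 0 := by
    refine tateTrace_eq_zero_of_sq (LinearMap.ext fun x => funext fun j => ?_)
    rw [Module.End.mul_apply, LinearMap.sub_apply, Pi.sub_apply, hΦ]
    by_cases hj : j ∈ s
    · rw [sum_extendByZero_apply_of_mem hj, sub_self]; rfl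
    · rw [sum_extendByZero_apply_of_notMem hj, sub_zero, LinearMap.sub_apply, Pi.sub_apply, hΦ,
        sum_extendByZero_apply_of_notMem hj, sub_zero, ← Module.End.mul_apply, hs j hj]
      rfl
  rw [tateTrace_sub hΦ' hsum, sub_eq_zero] at hν
  rw [hν, tateTrace_sum s h₀]
  exact Finset.sum_congr rfl fun i _ => tateTrace_extendByZero (hφ i)

/-- `P` is the identity on the stable subspace `A`, so the commutator restricts there to `[f, g] =
0`, while its image lies in `A`. -/
theorem commutator_projection_sq_eq_zero {V : Type*} [AddCommGroup V] [Module k V]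
    {A : Submodule k V} {P f g : Module.End k V} (hP : ∀ x, P x ∈ A) (hP' : ∀ x ∈ A, P x = x)
    (hfg : f * g = g * f) (hf : A.map f ≤ A) (hg : A.map g ≤ A) :
    ((P * f) * g - g * (P * f)) * ((P * f) * g - g * (P * f)) = 0 := by
  have hA : ∀ x ∈ A, ((P * f) * g - g * (P * f)) x = 0 := by
    intro x hx
    have hfx := hf (Submodule.mem_map_of_mem hx)
    have hgx := hf (Submodule.mem_map_of_mem (hg (Submodule.mem_map_of_mem hx)))
    simp only [LinearMap.sub_apply, Module.End.mul_apply]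
    rw [hP' _ hfx, hP' _ hgx, sub_eq_zero]
    exact LinearMap.congr_fun hfg x
  refine LinearMap.ext fun x => hA _ ?_
  exact A.sub_mem (hP _) (hg (Submodule.mem_map_of_mem (hP _)))

theorem lsmul_mem_E_pi (hB : ∀ (f : K) (i : I), Algebra.lsmul k k (U i) f ∈ E (B i))
    (hfin : ∀ f : K, ∀ᶠ i in Filter.cofinite, (B i).map (Algebra.lsmul k k (U i) f) ≤ B i)
    (f : K) : Algebra.lsmul k k (∀ i, U i) f ∈ E (Submodule.pi Set.univ B) :=
  have ⟨_, hs⟩ := exists_finset_of_eventually_cofinite (hfin f)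
  mem_E_pi (φ := fun i => Algebra.lsmul k k (U i) f) (fun _ _ => rfl) (hB f) hs

/-- The residue at a product is the sum of the residues at the factors. -/
theorem abstractResidue_pi (hB : ∀ (f : K) (i : I), Algebra.lsmul k k (U i) f ∈ E (B i))
    (hfin : ∀ f : K, ∀ᶠ i in Filter.cofinite, (B i).map (Algebra.lsmul k k (U i) f) ≤ B i)
    (f g : K) :
    ∃ s : Finset I,
      (∀ i ∉ s, abstractResidue K (B i) (f • KaehlerDifferential.D k K g) = 0) ∧
      abstractResidue K (Submodule.pi Set.univ B) (f • KaehlerDifferential.D k K g) =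
        ∑ i ∈ s, abstractResidue K (B i) (f • KaehlerDifferential.D k K g) := by
  choose P hP hP' using fun i => exists_projection (B i)
  -- The residue may be computed with any projection; this factorwise one makes the commutator
  -- diagonal.
  let Q : Module.End k (∀ i, U i) := LinearMap.pi fun i => P i ∘ₗ LinearMap.proj i
  have hQ : ∀ x, Q x ∈ Submodule.pi Set.univ B := fun x i _ => hP i _
  have hQ' : ∀ x ∈ Submodule.pi Set.univ B, Q x = x := fun x hx =>
    funext fun i => hP' i _ (hx i trivial)
  have hE := lsmul_mem_E_pi hB hfin
  obtain ⟨s, hs⟩ := exists_finset_of_eventually_cofinite ((hfin f).and (hfin g))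
  have hsq : ∀ i ∉ s,
      ((P i * Algebra.lsmul k k (U i) f) * Algebra.lsmul k k (U i) g -
        Algebra.lsmul k k (U i) g * (P i * Algebra.lsmul k k (U i) f)) *
      ((P i * Algebra.lsmul k k (U i) f) * Algebra.lsmul k k (U i) g -
        Algebra.lsmul k k (U i) g * (P i * Algebra.lsmul k k (U i) f)) = 0 := by
    intro i hi
    exact commutator_projection_sq_eq_zero (hP i) (hP' i)
      (by rw [← map_mul, mul_comm, map_mul]) (hs i hi).1 (hs i hi).2
  refine ⟨s, fun i hi => ?_, ?_⟩
  · rw [abstractResidue_smul_D (fun f => hB f i) (hP i) (hP' i)]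
    exact tateTrace_eq_zero_of_sq (hsq i hi)
  · rw [abstractResidue_smul_D hE hQ hQ', Finset.sum_congr rfl fun i _ =>
      abstractResidue_smul_D (fun f => hB f i) (hP i) (hP' i) f g]
    exact tateTrace_pi (fun x i => rfl) (commutator_projection_mem_E₀ hE hQ hQ' f g)
      (fun i => commutator_projection_mem_E₀ (fun f => hB f i) (hP i) (hP' i) f g) hsq

end Product

end

end SegalWilson

/-- `W i` is a `k`-subspace of `V` that is stable under all `g ∈ K`, that is, a `K`-submodule;
`K` acts diagonally on `∏ i, W i`. -/
theorem mainTheorem9 {k K V I : Type*} [Field k] [CharZero k] [CommRing K] [Algebra k K]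
    [AddCommGroup V] [Module k V] [Module K V] [IsScalarTower k K V]
    (A : I → Submodule k V) (W : I → Submodule K V)
    (hK : ∀ g : K, Algebra.lsmul k k V g ∈ SegalWilson.restrictedEnd A)
    (hAW : ∀ i, A i ≤ (W i).restrictScalars k) :
    -- the residue maps exist and are unique, and the functions `c` are 2-cocycles
    (∀ i, SegalWilson.HasAbstractResidue K (A i) ∧
      SegalWilson.IsTwoCocycle
        (fun g h : K => SegalWilson.segalWilsonCocycle (A i) g h)) ∧
    (∀ i, SegalWilson.HasAbstractResidue K (SegalWilson.subspaceIn (A i) (W i)) ∧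
      SegalWilson.IsTwoCocycle
        (fun g h : K =>
          SegalWilson.segalWilsonCocycle (SegalWilson.subspaceIn (A i) (W i)) g h)) ∧
    (SegalWilson.HasAbstractResidue K (SegalWilson.productSubspace A W) ∧
      SegalWilson.IsTwoCocycle
        (fun g h : K =>
          SegalWilson.segalWilsonCocycle (SegalWilson.productSubspace A W) g h)) ∧
    ∀ g h : K,
      -- only finitely many factors are different from 1
      (Function.mulSupport fun i =>
        SegalWilson.segalWilsonCocycle (SegalWilson.subspaceIn (A i) (W i)) g h).Finite ∧
      -- the product formula
      SegalWilson.segalWilsonCocycle (SegalWilson.productSubspace A W) g h =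
        ∏ᶠ i, SegalWilson.segalWilsonCocycle (SegalWilson.subspaceIn (A i) (W i)) g h ∧
      -- the reciprocity law
      (SegalWilson.segalWilsonCocycle (SegalWilson.productSubspace A W) g h = 1 →
        ∏ᶠ i, SegalWilson.segalWilsonCocycle (SegalWilson.subspaceIn (A i) (W i)) g h = 1) := by
  
  have hA : ∀ (i : I) (f : K), Algebra.lsmul k k V f ∈ SegalWilson.E (A i) :=
    fun i f => (hK f).1 i
  have hB : ∀ (f : K) (i : I), Algebra.lsmul k k (W i) f ∈
      SegalWilson.E (SegalWilson.subspaceIn (A i) (W i)) :=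
    fun f i => SegalWilson.lsmul_mem_E_subspaceIn (hAW i) (hA i f)
  have hfin : ∀ f : K, ∀ᶠ i in Filter.cofinite,
      (SegalWilson.subspaceIn (A i) (W i)).map (Algebra.lsmul k k (W i) f) ≤
        SegalWilson.subspaceIn (A i) (W i) := fun f =>
    (hK f).2.mono fun i hi => SegalWilson.map_lsmul_subspaceIn_le
      (hi.elim le_of_eq fun h => h.le.trans bot_le)
  refine ⟨fun i => ⟨SegalWilson.hasAbstractResidue (hA i),
      SegalWilson.isTwoCocycle_segalWilsonCocycle _⟩,
    fun i => ⟨SegalWilson.hasAbstractResidue fun f => hB f i,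
      SegalWilson.isTwoCocycle_segalWilsonCocycle _⟩,
    ⟨SegalWilson.hasAbstractResidue (SegalWilson.lsmul_mem_E_pi hB hfin),
      SegalWilson.isTwoCocycle_segalWilsonCocycle _⟩, fun g h => ?_⟩
  obtain ⟨s, hs, hsum⟩ := SegalWilson.abstractResidue_pi hB hfin g h
  have hsupp : (Function.mulSupport fun i =>
      SegalWilson.segalWilsonCocycle (SegalWilson.subspaceIn (A i) (W i)) g h) ⊆ s := by
    intro i hi
    by_contra his
    refine hi ?_
    simp only [SegalWilson.segalWilsonCocycle, hs i his, mul_zero, SegalWilson.expZSq_zero]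
  have hprod : SegalWilson.segalWilsonCocycle (SegalWilson.productSubspace A W) g h =
      ∏ᶠ i, SegalWilson.segalWilsonCocycle (SegalWilson.subspaceIn (A i) (W i)) g h := by
    -- `∏ᶠ` is `1` by default on infinite support, so the support bound is needed to obtain the
    -- actual product.
    rw [finprod_eq_prod_of_mulSupport_subset _ hsupp]
    simp only [SegalWilson.segalWilsonCocycle]
    rw [← SegalWilson.expZSq_sum, ← Finset.mul_sum, ← hsum]
    rfl
  exact ⟨s.finite_toSet.subset hsupp, hprod, fun h1 => hprod ▸ h1⟩
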